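/- **Theorem 1.** Let $K\ge 1$ and let $N_0,N_1,\dots,N_K$ be positive integers with $N_0=\min_{0\le k\le K}N_k$. Let $Q_1,\dots,Q_K$ be independent random matrices, where $Q_k$ has size $N_k\times N_{k-1}$ and its entries are i.i.d. circularly symmetric complex Gaussian variables with mean zero and unit variance, i.e. with density $\pi^{-1}e^{-|z|^2}$ on $\mathbb{C}$. Put $H=Q_KQ_{K-1}\cdots Q_1$, a matrix of size $N_K\times N_0$. Then $\det(H^\dagger H)>0$ almost surely, $\ln\det(H^\dagger H)$ is integrable, and $$\mathbb{E}\left[\ln\det(H^\dagger H)\right]=\sum_{k=1}^{K}\sum_{\ell=1}^{N_0}\psi(N_k-\ell+1)=-KN_0\gamma+\sum_{k=1}^{K}\sum_{\ell=1}^{N_0}\sum_{r=1}^{N_k-\ell}\frac1r,$$ where $\dagger$ denotes the conjugate transpose, $\psi=\Gamma'/\Gamma$ is the digamma function and $\gamma$ is the Euler–Mascheroni constant. -/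

import Mathlib

open MeasureTheory ProbabilityTheory

open scoped Matrix

/-- The standard circularly symmetric complex Gaussian law (mean zero, unit variance): the measure
on `ℂ` with density `π⁻¹ exp (-|z|²)` with respect to Lebesgue measure. -/
noncomputable def stdComplexGaussian : Measure ℂ :=
  volume.withDensity fun z => ENNReal.ofReal (Real.exp (-‖z‖ ^ 2) / Real.pi)

/-- The partial products `Q_k ⋯ Q_1` (the identity for `k = 0`) of a chain of matrices `Q_1, …, Q_K`
of sizes `N_k × N_{k-1}`. The matrix `Q_{k+1}` is `Q k` for `k : Fin K`. -/
noncomputable def chainProd {K : ℕ} {N : Fin (K + 1) → ℕ}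
    (Q : ∀ k : Fin K, Matrix (Fin (N k.succ)) (Fin (N k.castSucc)) ℂ) (i : Fin (K + 1)) :
    Matrix (Fin (N i)) (Fin (N 0)) ℂ :=
  Fin.induction (motive := fun i => Matrix (Fin (N i)) (Fin (N 0)) ℂ) 1
    (fun k P => Q k * P) i

/-- The product `H = Q_K ⋯ Q_1`, of size `N_K × N_0`. -/
noncomputable def productMatrix {K : ℕ} {N : Fin (K + 1) → ℕ}
    (Q : ∀ k : Fin K, Matrix (Fin (N k.succ)) (Fin (N k.castSucc)) ℂ) :
    Matrix (Fin (N (Fin.last K))) (Fin (N 0)) ℂ :=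
  chainProd Q (Fin.last K)

/-! Multiply the factors in one at a time. If `A` has independent columns, write `A = U * R` with
`Uᴴ * U = 1`. For a Gaussian matrix `G`, the matrix `G * U` is again Gaussian, by invariance of the
law, so the Gram determinant of `G * A` is that of `A` times a factor whose law does not depend on
`A` (`exists_gramDet_mul_eq`). The logarithmic means therefore add, and only a single Gaussian
matrix of size `N_k × N_0` remains.

That matrix is built column by column. A new column multiplies the Gram determinant by its squared
distance to the span of the previous ones (`gramDet_fromCols`), the squared norm of a Gaussian
vector in a space of complex dimension `d`. This follows the Gamma law of shape `d`, whose logarithm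
has mean `Γ'(d) / Γ(d)`.

Both inductions rest on `HasLogMean.mul_of_law`: positivity, integrability and mean pass to a
product when the law of the second factor is the same on almost every fibre. -/

/-! ### Digamma at positive integers -/

/-- The value at the positive integer `d` of the digamma function. -/
noncomputable def digammaNat (d : ℕ) : ℝ :=
  -Real.eulerMascheroniConstant + ∑ r ∈ Finset.Icc 1 (d - 1), 1 / (r : ℝ)

theorem digammaNat_succ (n : ℕ) :
    digammaNat (n + 1) = -Real.eulerMascheroniConstant + (harmonic n : ℝ) := by
  simp [digammaNat, harmonic_eq_sum_Icc]

theorem Complex.digamma_natCast {d : ℕ} (hd : 1 ≤ d) :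
    Complex.digamma (d : ℂ) = (digammaNat d : ℂ) := by
  obtain ⟨n, rfl⟩ : ∃ n, d = n + 1 := ⟨d - 1, by omega⟩
  have h0 : ((n.factorial : ℕ) : ℂ) ≠ 0 := by exact_mod_cast n.factorial_ne_zero
  rw [Complex.digamma_def, logDeriv_apply, digammaNat_succ]
  push_cast
  rw [Complex.deriv_Gamma_nat, Complex.Gamma_nat_eq_factorial, mul_div_cancel_left₀ _ h0]

/-- Differentiating the Mellin transform of `exp (-t)` at `n + 1` brings down `log t`; that
transform is `Γ`, whose derivative at `n + 1` is known. -/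
theorem integrableOn_log_mul_exp_neg_mul_pow (n : ℕ) :
    IntegrableOn (fun t : ℝ => t ^ n * (Real.log t * Real.exp (-t))) (Set.Ioi 0) ∧
    ∫ t in Set.Ioi (0 : ℝ), t ^ n * (Real.log t * Real.exp (-t)) =
      n.factorial * digammaNat (n + 1) := by
  have hs : (0 : ℝ) < ((n : ℂ) + 1).re := by simp; positivity
  have hmel := (mellin_hasDerivAt_of_isBigO_rpow (E := ℂ) (a := ((n : ℂ) + 1).re + 1) (b := 0)
    (f := fun x => (Real.exp (-x) : ℂ)) (s := (n : ℂ) + 1)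
    ((Complex.continuous_ofReal.comp (Real.continuous_exp.comp
      continuous_neg)).continuousOn.locallyIntegrableOn measurableSet_Ioi)
    (by
      rw [← Asymptotics.isBigO_norm_left]
      simp_rw [Complex.norm_real, Asymptotics.isBigO_norm_left]
      simpa only [neg_one_mul] using (isLittleO_exp_neg_mul_rpow_atTop zero_lt_one _).isBigO)
    (lt_add_one _)
    (by
      simp_rw [neg_zero, Real.rpow_zero]
      refine Asymptotics.isBigO_const_of_tendsto (y := (1 : ℂ)) ?_ one_ne_zero
      rw [(by simp : (1 : ℂ) = Real.exp (-0))]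
      exact (Complex.continuous_ofReal.comp
        (Real.continuous_exp.comp continuous_neg)).continuousWithinAt) hs)
  have hpt : ∀ t : ℝ, (t : ℂ) ^ ((n : ℂ) + 1 - 1) • (Real.log t • (Real.exp (-t) : ℂ)) =
      ((t ^ n * (Real.log t * Real.exp (-t)) : ℝ) : ℂ) := by
    intro t
    simp [Complex.cpow_natCast]
  have hint : IntegrableOn (fun t : ℝ => ((t ^ n * (Real.log t * Real.exp (-t)) : ℝ) : ℂ))
      (Set.Ioi 0) := by
    have := hmel.1
    unfold MellinConvergent at this
    simpa only [hpt] using this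
  refine ⟨by simpa only [IntegrableOn, RCLike.re_to_complex, Complex.ofReal_re] using hint.re, ?_⟩
  have hd : HasDerivAt Complex.Gamma (mellin (fun t => Real.log t • (Real.exp (-t) : ℂ))
      ((n : ℂ) + 1)) ((n : ℂ) + 1) := by
    have h1 := hmel.2
    rw [← Complex.GammaIntegral_eq_mellin] at h1
    refine h1.congr_of_eventuallyEq ?_
    -- The integral represents `Γ` only where the real part is positive, which holds near `n + 1`.
    filter_upwards [(isOpen_lt continuous_const Complex.continuous_re).mem_nhds hs] with z hz
    exact Complex.Gamma_eq_integral hz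
  have := hd.unique (Complex.hasDerivAt_Gamma_nat n)
  unfold mellin at this
  simp only [hpt] at this
  rw [integral_complex_ofReal] at this
  rw [digammaNat_succ]
  exact_mod_cast this

/-! ### Isotropic Gaussian measures -/

section Gaussian

variable (E : Type*) [NormedAddCommGroup E] [InnerProductSpace ℝ E] [FiniteDimensional ℝ E]
  [MeasurableSpace E] [BorelSpace E]

/-- The centred Gaussian measure on a Euclidean space with density proportional to
`exp (-‖x‖ ^ 2)`. -/
noncomputable def isotropicGaussian : Measure E :=
  volume.withDensity fun x =>
    ENNReal.ofReal (Real.exp (-‖x‖ ^ 2) / Real.pi ^ ((Module.finrank ℝ E : ℝ) / 2))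

theorem integrable_exp_neg_sq_norm : Integrable (fun x : E => Real.exp (-‖x‖ ^ 2)) := by
  have := GaussianFourier.integral_rexp_neg_mul_sq_norm (V := E) one_pos
  -- A non-integrable function has Bochner integral `0`, whereas the Gaussian integral is positive.
  by_contra h
  simp only [neg_one_mul] at this
  rw [integral_undef h] at this
  have : 0 < (Real.pi / 1) ^ ((Module.finrank ℝ E : ℝ) / 2) := by positivity
  linarith

instance isProbabilityMeasure_isotropicGaussian : IsProbabilityMeasure (isotropicGaussian E) := by
  refine ⟨?_⟩
  have hpos : 0 < Real.pi ^ ((Module.finrank ℝ E : ℝ) / 2) := by positivity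
  rw [isotropicGaussian, withDensity_apply _ MeasurableSet.univ, Measure.restrict_univ,
    ← ofReal_integral_eq_lintegral_ofReal ((integrable_exp_neg_sq_norm E).div_const _)
      (Filter.Eventually.of_forall fun x => by positivity), integral_div]
  have := GaussianFourier.integral_rexp_neg_mul_sq_norm (V := E) one_pos
  simp only [neg_one_mul, div_one] at this
  rw [this, div_self hpos.ne', ENNReal.ofReal_one]

variable {E}

theorem integral_isotropicGaussian {F : Type*} [NormedAddCommGroup F] [NormedSpace ℝ F]
    (f : E → F) :
    ∫ x, f x ∂(isotropicGaussian E) =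
      ∫ x, (Real.exp (-‖x‖ ^ 2) / Real.pi ^ ((Module.finrank ℝ E : ℝ) / 2)) • f x := by
  rw [isotropicGaussian, integral_withDensity_eq_integral_toReal_smul (by fun_prop) (by simp)]
  refine integral_congr_ae (Filter.Eventually.of_forall fun x => ?_)
  simp only
  rw [ENNReal.toReal_ofReal (by positivity)]

theorem integrable_isotropicGaussian_iff {F : Type*} [NormedAddCommGroup F] [NormedSpace ℝ F]
    (f : E → F) :
    Integrable f (isotropicGaussian E) ↔
      Integrable fun x =>
        (Real.exp (-‖x‖ ^ 2) / Real.pi ^ ((Module.finrank ℝ E : ℝ) / 2)) • f x := by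
  rw [isotropicGaussian, integrable_withDensity_iff_integrable_smul' (by fun_prop) (by simp)]
  refine integrable_congr (Filter.Eventually.of_forall fun x => ?_)
  simp only
  rw [ENNReal.toReal_ofReal (by positivity)]

theorem charFun_isotropicGaussian (t : E) :
    charFun (isotropicGaussian E) t = Complex.exp (-‖t‖ ^ 2 / 4) := by
  rw [charFun_apply, integral_isotropicGaussian]
  have h := GaussianFourier.integral_cexp_neg_mul_sq_norm_add (V := E) (b := 1) (by simp)
    Complex.I t
  have hpos : ((Real.pi ^ ((Module.finrank ℝ E : ℝ) / 2) : ℝ) : ℂ) ≠ 0 := by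
    exact_mod_cast (by positivity : 0 < Real.pi ^ ((Module.finrank ℝ E : ℝ) / 2)).ne'
  have hpt : ∀ x : E, (Real.exp (-‖x‖ ^ 2) / Real.pi ^ ((Module.finrank ℝ E : ℝ) / 2)) •
      Complex.exp ((inner ℝ x t : ℝ) * Complex.I) =
      Complex.exp (-1 * (‖x‖ : ℂ) ^ 2 + Complex.I * (inner ℝ t x : ℝ)) /
        ((Real.pi ^ ((Module.finrank ℝ E : ℝ) / 2) : ℝ) : ℂ) := by
    intro x
    rw [Complex.exp_add, Complex.real_smul, real_inner_comm, mul_comm Complex.I]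
    push_cast
    ring_nf
  simp_rw [hpt]
  rw [integral_div, h, Complex.ofReal_cpow Real.pi_pos.le]
  rw [Complex.ofReal_cpow Real.pi_pos.le] at hpos
  push_cast at hpos ⊢
  rw [div_one, mul_div_cancel_left₀ _ hpos]
  simp

/-- The characteristic function of the image at `t` is that of the source at `M t`, and it depends
only on `‖M t‖ = ‖t‖`. This covers isometric equivalences and orthogonal projections alike. -/
theorem map_isotropicGaussian {F : Type*} [NormedAddCommGroup F] [InnerProductSpace ℝ F]
    [FiniteDimensional ℝ F] [MeasurableSpace F] [BorelSpace F] (L : E → F) (hL : Measurable L)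
    (M : F → E) (hadj : ∀ x t, inner ℝ (L x) t = inner ℝ x (M t)) (hnorm : ∀ t, ‖M t‖ = ‖t‖) :
    (isotropicGaussian E).map L = isotropicGaussian F := by
  have := Measure.isProbabilityMeasure_map (μ := isotropicGaussian E) hL.aemeasurable
  have : CompleteSpace F := FiniteDimensional.complete ℝ F
  have : ProperSpace F := FiniteDimensional.proper ℝ F
  apply Measure.ext_of_charFun
  ext t
  rw [charFun_isotropicGaussian, charFun_apply, integral_map hL.aemeasurable (by fun_prop),
    ← hnorm t, ← charFun_isotropicGaussian, charFun_apply]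
  simp_rw [hadj]

end Gaussian

/-! ### Independent complex Gaussian families -/

theorem stdComplexGaussian_eq_isotropicGaussian :
    stdComplexGaussian = isotropicGaussian ℂ := by
  simp [stdComplexGaussian, isotropicGaussian, Complex.finrank_real_complex]

instance isProbabilityMeasure_stdComplexGaussian : IsProbabilityMeasure stdComplexGaussian := by
  rw [stdComplexGaussian_eq_isotropicGaussian]
  infer_instance

/-- The law of a finite family of independent standard complex Gaussian variables. -/
noncomputable def complexGaussianPi (ι : Type*) [Fintype ι] : Measure (ι → ℂ) :=
  Measure.pi fun _ => stdComplexGaussian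

instance isProbabilityMeasure_complexGaussianPi (ι : Type*) [Fintype ι] :
    IsProbabilityMeasure (complexGaussianPi ι) := by
  unfold complexGaussianPi
  infer_instance

theorem map_toLp_complexGaussianPi (ι : Type*) [Fintype ι] :
    (complexGaussianPi ι).map (WithLp.toLp 2) = isotropicGaussian (EuclideanSpace ℂ ι) := by
  have hm : Measurable (WithLp.toLp 2 : (ι → ℂ) → EuclideanSpace ℂ ι) := by fun_prop
  have := Measure.isProbabilityMeasure_map (μ := complexGaussianPi ι) hm.aemeasurable
  apply Measure.ext_of_charFun (E := EuclideanSpace ℂ ι)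
  ext t
  rw [complexGaussianPi, charFun_pi, charFun_isotropicGaussian]
  simp_rw [stdComplexGaussian_eq_isotropicGaussian, charFun_isotropicGaussian,
    ← Complex.exp_sum, ← Complex.ofReal_pow, EuclideanSpace.norm_sq_eq]
  simp [Finset.sum_div, neg_div]

theorem map_comp_complexGaussianPi {ι κ : Type*} [Fintype ι] [Fintype κ] {f : κ → ι}
    (hf : Function.Injective f) :
    (complexGaussianPi ι).map (fun x i => x (f i)) = complexGaussianPi κ := by
  have h : iIndepFun (fun (i : ι) (x : ι → ℂ) => x i) (complexGaussianPi ι) :=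
    iIndepFun_pi (X := fun _ => id) (fun _ => aemeasurable_id)
  rw [(iIndepFun_iff_map_fun_eq_pi_map fun i => (measurable_pi_apply (f i)).aemeasurable).1 (h.precomp hf),
    complexGaussianPi, complexGaussianPi]
  congr 1
  ext1 i
  exact (measurePreserving_eval (fun _ : ι => stdComplexGaussian) (f i)).map_eq

/-- Disjoint blocks of coordinates are independent; this separates a new column, or a new factor,
from the earlier entries. -/
theorem map_prodMk_complexGaussianPi {ι κ₁ κ₂ : Type*} [Fintype ι] [Fintype κ₁] [Fintype κ₂]
    {f : κ₁ → ι} {g : κ₂ → ι} (hf : Function.Injective f) (hg : Function.Injective g)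
    (hfg : ∀ i j, f i ≠ g j) :
    (complexGaussianPi ι).map (fun x => ((fun i => x (f i) : κ₁ → ℂ), (fun j => x (g j) : κ₂ → ℂ))) =
      (complexGaussianPi κ₁).prod (complexGaussianPi κ₂) := by
  have h := map_comp_complexGaussianPi (hf.sumElim hg hfg)
  have h2 := (measurePreserving_sumPiEquivProdPi
    (fun _ : κ₁ ⊕ κ₂ => stdComplexGaussian)).map_eq
  change _ = (complexGaussianPi κ₁).prod (complexGaussianPi κ₂) at h2
  change (complexGaussianPi (κ₁ ⊕ κ₂)).map _ = _ at h2
  rw [← h2, ← h, Measure.map_map (by fun_prop) (by fun_prop)]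
  rfl

/-! ### Additivity of logarithmic means -/

/-- `f` is almost surely positive, and `log f` is integrable with mean `c`. -/
structure HasLogMean {α : Type*} [MeasurableSpace α] (f : α → ℝ) (μ : Measure α) (c : ℝ) :
    Prop where
  pos : ∀ᵐ x ∂μ, 0 < f x
  integrable : Integrable (fun x => Real.log (f x)) μ
  integral_eq : ∫ x, Real.log (f x) ∂μ = c

namespace HasLogMean

variable {α β : Type*} [MeasurableSpace α] [MeasurableSpace β] {μ : Measure α} {ν : Measure β}
  {c d : ℝ}

theorem map_iff {T : α → β} (hT : AEMeasurable T μ) {f : β → ℝ} (hf : Measurable f) :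
    HasLogMean f (μ.map T) c ↔ HasLogMean (fun x => f (T x)) μ c := by
  have hlog : Measurable fun x => Real.log (f x) := hf.log
  constructor
  · rintro ⟨h1, h2, h3⟩
    refine ⟨(ae_map_iff hT (measurableSet_lt measurable_const hf)).1 h1,
      (integrable_map_measure hlog.aestronglyMeasurable hT).1 h2, ?_⟩
    rwa [integral_map hT hlog.aestronglyMeasurable] at h3
  · rintro ⟨h1, h2, h3⟩
    refine ⟨(ae_map_iff hT (measurableSet_lt measurable_const hf)).2 h1,
      (integrable_map_measure hlog.aestronglyMeasurable hT).2 h2, ?_⟩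
    rwa [integral_map hT hlog.aestronglyMeasurable]

/-- If `F a b = f a * g` where, for every fixed `a`, the factor `g` has the law `ρ`, then the
logarithmic means add up. -/
theorem mul_of_law [IsProbabilityMeasure μ] [IsProbabilityMeasure ν] {f : α → ℝ}
    (hf : HasLogMean f μ c) {F : α × β → ℝ} (hfm : Measurable f) (hF : Measurable F)
    {ρ : Measure ℝ} (hρ : HasLogMean id ρ d)
    (hlaw : ∀ a, 0 < f a → ∃ g : β → ℝ, Measurable g ∧ ν.map g = ρ ∧ ∀ b, F (a, b) = f a * g b) :
    HasLogMean F (μ.prod ν) (c + d) := by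
  have hgm : Measurable fun p : α × β => F p / f p.1 := hF.div (hfm.comp measurable_fst)
  have hfib : ∀ᵐ a ∂μ, 0 < f a ∧ HasLogMean (fun b => F (a, b) / f a) ν d ∧
      ∫ b, ‖Real.log (F (a, b) / f a)‖ ∂ν = ∫ x, ‖Real.log x‖ ∂ρ := by
    filter_upwards [hf.pos] with a ha
    obtain ⟨g, hg, rfl, hFg⟩ := hlaw a ha
    have hdiv : ∀ b, F (a, b) / f a = g b := fun b => by
      rw [hFg, mul_div_cancel_left₀ _ ha.ne']
    simp_rw [hdiv]
    refine ⟨ha, (map_iff hg.aemeasurable measurable_id).1 hρ, ?_⟩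
    rw [integral_map hg.aemeasurable Real.measurable_log.norm.aestronglyMeasurable]
  have hgpos : ∀ᵐ p ∂(μ.prod ν), 0 < F p / f p.1 := by
    rw [Measure.ae_prod_iff_ae_ae (measurableSet_lt measurable_const hgm)]
    filter_upwards [hfib] with a ha using ha.2.1.pos
  have hfpos : ∀ᵐ p ∂(μ.prod ν), 0 < f p.1 :=
    Measure.quasiMeasurePreserving_fst.ae hf.pos
  have hgint : Integrable (fun p : α × β => Real.log (F p / f p.1)) (μ.prod ν) := by
    rw [integrable_prod_iff hgm.log.aestronglyMeasurable]
    refine ⟨by filter_upwards [hfib] with a ha using ha.2.1.integrable, ?_⟩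
    -- The `L¹` norm on a fibre depends only on `ρ`, so it is almost everywhere constant and hence
    -- integrable in `a`.
    refine (integrable_const (∫ x, ‖Real.log x‖ ∂ρ)).congr ?_
    filter_upwards [hfib] with a ha using ha.2.2.symm
  have hfint : Integrable (fun p : α × β => Real.log (f p.1)) (μ.prod ν) :=
    hf.integrable.comp_fst ν
  have hsum : (fun p : α × β => Real.log (f p.1) + Real.log (F p / f p.1)) =ᵐ[μ.prod ν]
      fun p => Real.log (F p) := by
    filter_upwards [hgpos, hfpos] with p h1 h2
    rw [← Real.log_mul h2.ne' h1.ne', mul_div_cancel₀ _ h2.ne']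
  refine ⟨?_, (hfint.add hgint).congr hsum, ?_⟩
  · filter_upwards [hgpos, hfpos] with p h1 h2
    have := mul_pos h1 h2
    rwa [div_mul_cancel₀ _ h2.ne'] at this
  · rw [← integral_congr_ae hsum, integral_add hfint hgint, integral_prod _ hfint,
      integral_prod _ hgint]
    congr 1
    · simpa using hf.integral_eq
    · rw [← mul_one d, ← probReal_univ (μ := μ), mul_comm, ← smul_eq_mul, ← integral_const]
      refine integral_congr_ae ?_
      filter_upwards [hfib] with a ha using ha.2.1.integral_eq

end HasLogMean

/-! ### Squared norm of a Gaussian vector -/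

section NormSq

variable {E : Type*} [NormedAddCommGroup E] [InnerProductSpace ℝ E] [FiniteDimensional ℝ E]
  [MeasurableSpace E] [BorelSpace E]

/-- Polar coordinates and `u = r ^ 2` turn `r ^ (2 * n + 1) dr` into `u ^ n du / 2`. The value of
`C` is not needed: taking `f = 1` later determines it. -/
theorem exists_radial_isotropicGaussian {n : ℕ} (hE : Module.finrank ℝ E = 2 * (n + 1)) :
    ∃ C : ℝ, ∀ f : ℝ → ℝ,
      ∫ x, f (‖x‖ ^ 2) ∂(isotropicGaussian E) =
        C * ∫ u in Set.Ioi (0 : ℝ), u ^ n * (f u * Real.exp (-u)) := by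
  have : Nontrivial E := Module.nontrivial_of_finrank_pos (R := ℝ) (by omega)
  refine ⟨(2 * (n + 1)) * (volume : Measure E).real (Metric.ball 0 1) /
    Real.pi ^ ((Module.finrank ℝ E : ℝ) / 2) / 2, fun f => ?_⟩
  rw [integral_isotropicGaussian]
  rw [integral_fun_norm_addHaar volume (fun r : ℝ =>
    (Real.exp (-r ^ 2) / Real.pi ^ ((Module.finrank ℝ E : ℝ) / 2)) • f (r ^ 2)),
    ← integral_comp_rpow_Ioi (fun u : ℝ => u ^ n * (f u * Real.exp (-u))) (two_ne_zero (α := ℝ)),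
    nsmul_eq_mul, smul_eq_mul]
  have h : ∀ y ∈ Set.Ioi (0 : ℝ), y ^ (Module.finrank ℝ E - 1) •
      (Real.exp (-y ^ 2) / Real.pi ^ ((Module.finrank ℝ E : ℝ) / 2)) • f (y ^ 2) =
      (1 / (2 * Real.pi ^ ((Module.finrank ℝ E : ℝ) / 2))) * ((|2| * y ^ ((2 : ℝ) - 1)) •
        ((y ^ (2 : ℝ)) ^ n * (f (y ^ (2 : ℝ)) * Real.exp (-y ^ (2 : ℝ))))) := by
    intro y _
    have h1 : (2 : ℝ) - 1 = 1 := by norm_num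
    have h2 : 2 * (n + 1) - 1 = 2 * n + 1 := by omega
    rw [h1, Real.rpow_one, Real.rpow_two, abs_two, hE, h2]
    simp only [smul_eq_mul]
    field_simp
    ring
  rw [setIntegral_congr_fun measurableSet_Ioi h, integral_const_mul, hE]
  push_cast
  field_simp

theorem integrable_radial_isotropicGaussian {n : ℕ} (hE : Module.finrank ℝ E = 2 * (n + 1))
    {f : ℝ → ℝ}
    (hf : IntegrableOn (fun u : ℝ => u ^ n * (f u * Real.exp (-u))) (Set.Ioi 0)) :
    Integrable (fun x => f (‖x‖ ^ 2)) (isotropicGaussian E) := by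
  have : Nontrivial E := Module.nontrivial_of_finrank_pos (R := ℝ) (by omega)
  rw [integrable_isotropicGaussian_iff]
  rw [integrable_fun_norm_addHaar volume (f := fun r : ℝ =>
    (Real.exp (-r ^ 2) / Real.pi ^ ((Module.finrank ℝ E : ℝ) / 2)) • f (r ^ 2))]
  rw [← integrableOn_Ioi_comp_rpow_iff _ (two_ne_zero (α := ℝ))] at hf
  refine IntegrableOn.congr_fun
    (hf.const_mul (1 / (2 * Real.pi ^ ((Module.finrank ℝ E : ℝ) / 2)))) ?_ measurableSet_Ioi
  intro y _
  have h1 : (2 : ℝ) - 1 = 1 := by norm_num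
  have h2 : 2 * (n + 1) - 1 = 2 * n + 1 := by omega
  simp only [h1, Real.rpow_one, Real.rpow_two, abs_two, hE, h2, smul_eq_mul]
  field_simp
  ring

theorem hasLogMean_norm_sq_isotropicGaussian {d : ℕ} (hd : 1 ≤ d)
    (hE : Module.finrank ℝ E = 2 * d) :
    HasLogMean (fun x => ‖x‖ ^ 2) (isotropicGaussian E) (digammaNat d) := by
  obtain ⟨n, rfl⟩ : ∃ n, d = n + 1 := ⟨d - 1, by omega⟩
  have : Nontrivial E := Module.nontrivial_of_finrank_pos (R := ℝ) (by omega)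
  obtain ⟨C, hC⟩ := exists_radial_isotropicGaussian hE
  have hlog := integrableOn_log_mul_exp_neg_mul_pow n
  refine ⟨?_, integrable_radial_isotropicGaussian hE hlog.1, ?_⟩
  · have h0 : ∀ᵐ x ∂(volume : Measure E), x ≠ 0 := by
      simp [ae_iff]
    filter_upwards [(withDensity_absolutelyContinuous _ _).ae_le h0] with x hx
    positivity
  · rw [hC, hlog.2]
    -- Total mass one gives `C * n! = 1`.
    have h1 := hC fun _ => 1
    have h2 : ∫ u in Set.Ioi (0 : ℝ), u ^ n * (1 * Real.exp (-u)) = n.factorial := by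
      rw [← Real.Gamma_nat_eq_factorial, Real.Gamma_eq_integral (by positivity)]
      refine setIntegral_congr_fun measurableSet_Ioi fun u _ => ?_
      simp [mul_comm]
    rw [h2] at h1
    simp only [integral_const, probReal_univ, smul_eq_mul, mul_one] at h1
    rw [← mul_assoc, ← h1, one_mul]

end NormSq

/-! ### Gram determinants and invariance of Gaussian matrices -/

section GramDet

variable {m n p : Type*} [Fintype m] [Fintype n] [Fintype p] [DecidableEq n]

/-- The Gram determinant `det (Aᴴ A)` of the columns of a complex matrix, as a real number. -/
noncomputable def gramDet (A : Matrix m n ℂ) : ℝ := (Aᴴ * A).det.re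

open scoped ComplexOrder in
theorem det_conjTranspose_mul_self_eq_gramDet (A : Matrix m n ℂ) :
    (Aᴴ * A).det = (gramDet A : ℂ) := by
  have h := (Matrix.posSemidef_conjTranspose_mul_self A).det_nonneg
  exact Complex.ext rfl (by simpa using (Complex.nonneg_iff.1 h).2.symm)

theorem gramDet_one : gramDet (1 : Matrix n n ℂ) = 1 := by simp [gramDet]

theorem gramDet_submatrix_equiv {l : Type*} [Fintype l] [DecidableEq l] (A : Matrix m n ℂ)
    (e : l ≃ n) : gramDet (A.submatrix id e) = gramDet A := by
  unfold gramDet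
  rw [Matrix.conjTranspose_submatrix, ← Matrix.submatrix_mul _ _ _ id _ Function.bijective_id,
    Matrix.det_submatrix_equiv_self]

theorem gramDet_mul_square (A : Matrix m n ℂ) (R : Matrix n n ℂ) :
    gramDet (A * R) = gramDet A * ‖R.det‖ ^ 2 := by
  have h : ((A * R)ᴴ * (A * R)).det = ((gramDet A * ‖R.det‖ ^ 2 : ℝ) : ℂ) := by
    rw [Matrix.conjTranspose_mul, Matrix.mul_assoc, ← Matrix.mul_assoc Aᴴ, Matrix.det_mul,
      Matrix.det_mul, Matrix.det_conjTranspose, det_conjTranspose_mul_self_eq_gramDet]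
    push_cast
    rw [← Complex.conj_mul', starRingEnd_apply]
    ring
  unfold gramDet at h ⊢
  rw [h, Complex.ofReal_re]

open scoped ComplexOrder MatrixOrder in
/-- Polar decomposition of a matrix with linearly independent columns. -/
theorem exists_eq_mul_of_gramDet_pos (A : Matrix m n ℂ) (hA : 0 < gramDet A) :
    ∃ (U : Matrix m n ℂ) (R : Matrix n n ℂ), Uᴴ * U = 1 ∧ A = U * R := by
  -- Any `R` with `Rᴴ * R = Aᴴ * A` will do: it is invertible because the Gram determinant is
  -- nonzero, and `U = A * R⁻¹`.
  obtain ⟨R, hR⟩ := CStarAlgebra.nonneg_iff_eq_star_mul_self.mp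
    (Matrix.posSemidef_conjTranspose_mul_self A).nonneg
  rw [Matrix.star_eq_conjTranspose] at hR
  have hdet : IsUnit R.det := by
    rw [isUnit_iff_ne_zero]
    intro h0
    rw [gramDet, hR, Matrix.det_mul, h0] at hA
    simp at hA
  refine ⟨A * R⁻¹, R, ?_, ?_⟩
  · rw [Matrix.conjTranspose_mul, Matrix.mul_assoc, ← Matrix.mul_assoc Aᴴ, hR,
      Matrix.mul_assoc, Matrix.mul_nonsing_inv _ hdet, Matrix.mul_one,
      ← Matrix.conjTranspose_mul, Matrix.mul_nonsing_inv _ hdet, Matrix.conjTranspose_one]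
  · rw [Matrix.mul_assoc, Matrix.nonsing_inv_mul _ hdet, Matrix.mul_one]

theorem continuous_gramDet : Continuous (gramDet : Matrix m n ℂ → ℝ) := by
  unfold gramDet
  fun_prop

theorem measurable_gramDet_of {ι : Type*} [Countable ι] {M : (ι → ℂ) → Matrix m n ℂ}
    (hM : Continuous M) : Measurable fun x => gramDet (M x) :=
  (continuous_gramDet.comp hM).measurable

/-- The matrix with a given family of entries. -/
def matrixOfEntries {m n : Type*} (x : m × n → ℂ) : Matrix m n ℂ := Matrix.of fun i j => x (i, j)

theorem continuous_matrixOfEntries {m n : Type*} :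
    Continuous (matrixOfEntries : (m × n → ℂ) → Matrix m n ℂ) := by
  unfold matrixOfEntries
  exact continuous_matrix fun i j => by fun_prop

/-- Adjointness and isometry of multiplication maps thereby reduce to cyclicity of the trace. -/
theorem sum_inner_eq_re_trace {m n : Type*} [Fintype m] [Fintype n] (A B : Matrix m n ℂ) :
    ∑ q : m × n, inner ℝ (A q.1 q.2) (B q.1 q.2) = (Aᴴ * B).trace.re := by
  simp only [Fintype.sum_prod_type, Matrix.trace, Matrix.diag_apply, Matrix.mul_apply,
    Matrix.conjTranspose_apply, Complex.re_sum, Complex.inner]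
  rw [Finset.sum_comm]
  simp [mul_comm]

theorem measurable_entries_mul {m n p : Type*} [Countable m] [Countable n] [Fintype p] (U : Matrix p n ℂ) :
    Measurable fun (x : m × p → ℂ) (q : m × n) => (matrixOfEntries x * U) q.1 q.2 :=
  Continuous.measurable <| continuous_pi fun q =>
    ((continuous_matrixOfEntries (m := m) (n := p)).matrix_mul
      continuous_const).matrix_elem q.1 q.2

theorem map_complexGaussianPi_of_adjoint {ι κ : Type*} [Fintype ι] [Fintype κ]
    (L : (ι → ℂ) → κ → ℂ) (hL : Measurable L) (M : (κ → ℂ) → ι → ℂ)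
    (hadj : ∀ x t, ∑ i, inner ℝ (L x i) (t i) = ∑ i, inner ℝ (x i) (M t i))
    (hnorm : ∀ t, ∑ i, inner ℝ (M t i) (M t i) = ∑ i, inner ℝ (t i) (t i)) :
    (complexGaussianPi ι).map L = complexGaussianPi κ := by
  have h1 : Measurable (WithLp.toLp 2 : (κ → ℂ) → EuclideanSpace ℂ κ) := WithLp.measurable_toLp _ _
  have h2 : Measurable (WithLp.ofLp : EuclideanSpace ℂ ι → ι → ℂ) := WithLp.measurable_ofLp _ _
  have h3 : Measurable (WithLp.toLp 2 : (ι → ℂ) → EuclideanSpace ℂ ι) := WithLp.measurable_toLp _ _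
  have h4 : Measurable (WithLp.ofLp : EuclideanSpace ℂ κ → κ → ℂ) := WithLp.measurable_ofLp _ _
  have h5 : Measurable fun x : EuclideanSpace ℂ ι => WithLp.toLp 2 (L x.ofLp) :=
    h1.comp (hL.comp h2)
  have key := map_isotropicGaussian (E := EuclideanSpace ℂ ι) (F := EuclideanSpace ℂ κ)
    (fun x => WithLp.toLp 2 (L x.ofLp)) h5
    (fun t => WithLp.toLp 2 (M t.ofLp))
    (fun x t => by rw [PiLp.inner_apply, PiLp.inner_apply]; exact hadj _ _)
    (fun t => by
      rw [← sq_eq_sq₀ (norm_nonneg _) (norm_nonneg _), ← real_inner_self_eq_norm_sq,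
        ← real_inner_self_eq_norm_sq, PiLp.inner_apply, PiLp.inner_apply]
      exact hnorm _)
  rw [← map_toLp_complexGaussianPi, ← map_toLp_complexGaussianPi,
    Measure.map_map h5 h3] at key
  have h := congrArg (Measure.map WithLp.ofLp) key
  rw [Measure.map_map h4 (h5.comp h3), Measure.map_map h4 h1] at h
  have hid : (WithLp.ofLp ∘ WithLp.toLp 2 : (κ → ℂ) → κ → ℂ) = id := rfl
  rw [hid, Measure.map_id] at h
  exact h

/-- The adjoint of right multiplication by `U` is right multiplication by `Uᴴ`, an isometry because
`Uᴴ * U = 1`. -/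
theorem map_mul_complexGaussianPi (U : Matrix p n ℂ) (hU : Uᴴ * U = 1) :
    (complexGaussianPi (m × p)).map (fun x q => (matrixOfEntries x * U) q.1 q.2) =
      complexGaussianPi (m × n) := by
  refine map_complexGaussianPi_of_adjoint _ (measurable_entries_mul U)
    (fun t q => (matrixOfEntries t * Uᴴ) q.1 q.2) (fun x t => ?_) (fun t => ?_)
  · have h1 := sum_inner_eq_re_trace (matrixOfEntries x * U) (matrixOfEntries t)
    have h2 := sum_inner_eq_re_trace (matrixOfEntries x) (matrixOfEntries t * Uᴴ)
    refine h1.trans (Eq.trans ?_ h2.symm)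
    rw [Matrix.conjTranspose_mul, Matrix.mul_assoc, Matrix.trace_mul_comm, Matrix.mul_assoc]
  · have h1 := sum_inner_eq_re_trace (matrixOfEntries t * Uᴴ) (matrixOfEntries t * Uᴴ)
    have h2 := sum_inner_eq_re_trace (matrixOfEntries t) (matrixOfEntries t)
    refine h1.trans (Eq.trans ?_ h2.symm)
    rw [Matrix.conjTranspose_mul, Matrix.conjTranspose_conjTranspose, Matrix.mul_assoc,
      Matrix.trace_mul_comm, Matrix.mul_assoc, Matrix.mul_assoc, hU, Matrix.mul_one]

/-- For a fixed matrix `A` with linearly independent columns and a Gaussian matrix `G`, the ratio of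
the Gram determinants of `G * A` and `A` is distributed as that of a Gaussian matrix. -/
theorem exists_gramDet_mul_eq (A : Matrix p n ℂ) (hA : 0 < gramDet A) :
    ∃ g : (m × p → ℂ) → ℝ, Measurable g ∧
      (complexGaussianPi (m × p)).map g =
        (complexGaussianPi (m × n)).map (fun y => gramDet (matrixOfEntries y)) ∧
      ∀ x, gramDet (matrixOfEntries x * A) = gramDet A * g x := by
  obtain ⟨U, R, hU, rfl⟩ := exists_eq_mul_of_gramDet_pos A hA
  refine ⟨fun x => gramDet (matrixOfEntries x * U),
    measurable_gramDet_of (continuous_matrixOfEntries.matrix_mul continuous_const), ?_, ?_⟩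
  · rw [← map_mul_complexGaussianPi U hU,
      Measure.map_map (measurable_gramDet_of continuous_matrixOfEntries)
        (measurable_entries_mul U)]
    rfl
  · intro x
    have h1 : gramDet U = 1 := by simp [gramDet, hU]
    rw [← Matrix.mul_assoc, gramDet_mul_square, gramDet_mul_square, h1]
    ring

end GramDet

/-! ### Appending a column -/

section AppendColumn

variable {m n : Type*} [Fintype m] [Fintype n] [DecidableEq n]

/-- A block unitriangular factor removes `W *ᵥ c` without changing the determinant; the remaining
Gram matrix is block diagonal. -/
theorem gramDet_fromCols_of_orthogonal (W : Matrix m n ℂ) (c : n → ℂ) (s : m → ℂ)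
    (hs : Wᴴ *ᵥ s = 0) :
    gramDet (Matrix.fromCols W (Matrix.replicateCol (Fin 1) (W *ᵥ c + s))) =
      gramDet W * ∑ i, ‖s i‖ ^ 2 := by
  have h : Matrix.fromCols W (Matrix.replicateCol (Fin 1) (W *ᵥ c + s)) =
      Matrix.fromCols W (Matrix.replicateCol (Fin 1) s) *
        (Matrix.fromBlocks 1 (Matrix.replicateCol (Fin 1) c) 0 1 :
          Matrix (n ⊕ Fin 1) (n ⊕ Fin 1) ℂ) := by
    rw [Matrix.fromCols_mul_fromBlocks]
    simp [Matrix.replicateCol_mulVec, Matrix.replicateCol_add]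
  have h2 : Wᴴ * Matrix.replicateCol (Fin 1) s = 0 := by
    rw [← Matrix.replicateCol_mulVec, hs, Matrix.replicateCol_zero]
  rw [h, gramDet_mul_square, Matrix.det_fromBlocks_zero₂₁, Matrix.det_one, Matrix.det_one]
  have h3 : ((Matrix.fromCols W (Matrix.replicateCol (Fin 1) s))ᴴ *
      Matrix.fromCols W (Matrix.replicateCol (Fin 1) s)).det =
      ((gramDet W * ∑ i, ‖s i‖ ^ 2 : ℝ) : ℂ) := by
    rw [Matrix.conjTranspose_fromCols_eq_fromRows_conjTranspose, Matrix.fromRows_mul_fromCols,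
      h2, Matrix.det_fromBlocks_zero₁₂, det_conjTranspose_mul_self_eq_gramDet, Matrix.det_fin_one]
    simp [Matrix.mul_apply, Complex.conj_mul']
  rw [gramDet, h3, Complex.ofReal_re]
  simp

/-- The orthogonal complement of the column space of a complex matrix, as a real subspace. -/
noncomputable def columnsOrthogonal (W : Matrix m n ℂ) : Submodule ℝ (EuclideanSpace ℂ m) :=
  LinearMap.ker ((Wᴴ.mulVecLin.restrictScalars ℝ) ∘ₗ
    ((WithLp.linearEquiv 2 ℝ (m → ℂ)).toLinearMap : EuclideanSpace ℂ m →ₗ[ℝ] m → ℂ))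

theorem mem_columnsOrthogonal {m n : Type*} [Fintype m] {W : Matrix m n ℂ} {x : EuclideanSpace ℂ m} :
    x ∈ columnsOrthogonal W ↔ Wᴴ *ᵥ x.ofLp = 0 := by
  simp [columnsOrthogonal]

theorem isUnit_det_of_gramDet_pos {W : Matrix m n ℂ} (hW : 0 < gramDet W) :
    IsUnit (Wᴴ * W).det := by
  rw [isUnit_iff_ne_zero, det_conjTranspose_mul_self_eq_gramDet]
  exact_mod_cast hW.ne'

theorem finrank_columnsOrthogonal {W : Matrix m n ℂ} (hW : 0 < gramDet W) :
    Module.finrank ℝ (columnsOrthogonal W) = 2 * (Fintype.card m - Fintype.card n) := by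
  have hsurj : Function.Surjective ((Wᴴ.mulVecLin.restrictScalars ℝ) ∘ₗ
      ((WithLp.linearEquiv 2 ℝ (m → ℂ)).toLinearMap : EuclideanSpace ℂ m →ₗ[ℝ] m → ℂ)) := by
    intro y
    -- `W * (Wᴴ * W)⁻¹` is a right inverse of `Wᴴ`, so rank–nullity gives the dimension.
    refine ⟨WithLp.toLp 2 (W *ᵥ ((Wᴴ * W)⁻¹ *ᵥ y)), ?_⟩
    simp [Matrix.mulVec_mulVec, ← Matrix.mul_assoc,
      Matrix.mul_nonsing_inv _ (isUnit_det_of_gramDet_pos hW)]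
  have h := LinearMap.finrank_range_add_finrank_ker ((Wᴴ.mulVecLin.restrictScalars ℝ) ∘ₗ
      ((WithLp.linearEquiv 2 ℝ (m → ℂ)).toLinearMap : EuclideanSpace ℂ m →ₗ[ℝ] m → ℂ))
  rw [LinearMap.range_eq_top.2 hsurj, finrank_top] at h
  have h1 : Module.finrank ℝ (n → ℂ) = 2 * Fintype.card n := by
    simp [Module.finrank_pi_fintype, Complex.finrank_real_complex, mul_comm]
  have h2 : Module.finrank ℝ (EuclideanSpace ℂ m) = 2 * Fintype.card m := by
    rw [(WithLp.linearEquiv 2 ℝ (m → ℂ)).finrank_eq]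
    simp [Module.finrank_pi_fintype, Complex.finrank_real_complex, mul_comm]
  rw [h1, h2] at h
  change _ + Module.finrank ℝ (columnsOrthogonal W) = _ at h
  omega

theorem gramDet_fromCols {W : Matrix m n ℂ} (hW : 0 < gramDet W) (x : m → ℂ) :
    gramDet (Matrix.fromCols W (Matrix.replicateCol (Fin 1) x)) =
      gramDet W * ‖(columnsOrthogonal W).orthogonalProjectionOnto (WithLp.toLp 2 x)‖ ^ 2 := by
  -- The normal equations: `W *ᵥ c` is the projection of `x` onto the column space and `s` the
  -- residual.
  set c := (Wᴴ * W)⁻¹ *ᵥ (Wᴴ *ᵥ x) with hc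
  set s := x - W *ᵥ c with hs
  have hx : x = W *ᵥ c + s := by rw [hs]; abel
  have hs0 : Wᴴ *ᵥ s = 0 := by
    rw [hs, Matrix.mulVec_sub, hc, Matrix.mulVec_mulVec, Matrix.mulVec_mulVec,
      Matrix.mul_nonsing_inv _ (isUnit_det_of_gramDet_pos hW), Matrix.one_mulVec, sub_self]
  have hproj : (WithLp.toLp 2 s : EuclideanSpace ℂ m) =
      (columnsOrthogonal W).starProjection (WithLp.toLp 2 x) := by
    symm
    refine Submodule.eq_starProjection_of_mem_of_inner_eq_zero (mem_columnsOrthogonal.2 hs0) ?_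
    intro w hw
    rw [mem_columnsOrthogonal] at hw
    have hd : (WithLp.toLp 2 x - WithLp.toLp 2 s : EuclideanSpace ℂ m) =
        WithLp.toLp 2 (W *ᵥ c) := by
      rw [← WithLp.toLp_sub, hs, sub_sub_cancel]
    rw [hd, PiLp.inner_apply]
    have : (star (W *ᵥ c) ⬝ᵥ w.ofLp).re = 0 := by
      rw [Matrix.star_mulVec, ← Matrix.dotProduct_mulVec, hw, dotProduct_zero, Complex.zero_re]
    rw [← this]
    simp [dotProduct, Complex.inner, mul_comm]
  conv_lhs => rw [hx]
  rw [gramDet_fromCols_of_orthogonal W c s hs0]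
  have hn : ‖(columnsOrthogonal W).orthogonalProjectionOnto (WithLp.toLp 2 x)‖ =
      ‖(WithLp.toLp 2 s : EuclideanSpace ℂ m)‖ := by
    rw [hproj]
    rfl
  rw [hn, EuclideanSpace.norm_sq_eq]

theorem map_norm_sq_isotropicGaussian_eq {E F : Type*} [NormedAddCommGroup E]
    [InnerProductSpace ℝ E] [FiniteDimensional ℝ E] [MeasurableSpace E] [BorelSpace E]
    [NormedAddCommGroup F] [InnerProductSpace ℝ F] [FiniteDimensional ℝ F] [MeasurableSpace F]
    [BorelSpace F] (h : Module.finrank ℝ E = Module.finrank ℝ F) :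
    (isotropicGaussian E).map (fun x => ‖x‖ ^ 2) =
      (isotropicGaussian F).map (fun x => ‖x‖ ^ 2) := by
  let e : E ≃ₗᵢ[ℝ] F := 
    (stdOrthonormalBasis ℝ E).equiv (stdOrthonormalBasis ℝ F) (finCongr h)
  have he : Measurable e := e.continuous.measurable
  rw [← map_isotropicGaussian e he e.symm (fun x t => by
      rw [← e.symm.inner_map_map, e.symm_apply_apply]) (fun t => e.symm.norm_map t),
    Measure.map_map (by fun_prop) he]
  congr 1
  ext x
  simp

/-- The projection of the new column is Gaussian on a subspace depending on `W`, but the law of its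
squared norm depends only on the dimension, so a fixed space can stand in. -/
theorem exists_gramDet_fromCols_eq {d : ℕ} (hd : d = Fintype.card m - Fintype.card n)
    (W : Matrix m n ℂ) (hW : 0 < gramDet W) :
    ∃ g : (m → ℂ) → ℝ, Measurable g ∧
      (complexGaussianPi m).map g =
        (isotropicGaussian (EuclideanSpace ℂ (Fin d))).map (fun y => ‖y‖ ^ 2) ∧
      ∀ x, gramDet (Matrix.fromCols W (Matrix.replicateCol (Fin 1) x)) = gramDet W * g x := by
  have hto : Measurable (WithLp.toLp 2 : (m → ℂ) → EuclideanSpace ℂ m) :=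
    WithLp.measurable_toLp _ _
  have hpr : Measurable (columnsOrthogonal W).orthogonalProjectionOnto :=
    (ContinuousLinearMap.continuous _).measurable
  have hsq : Measurable fun y : columnsOrthogonal W => ‖y‖ ^ 2 := by fun_prop
  refine ⟨fun x => ‖(columnsOrthogonal W).orthogonalProjectionOnto (WithLp.toLp 2 x)‖ ^ 2,
    hsq.comp (hpr.comp hto), ?_, gramDet_fromCols hW⟩
  have hfin : Module.finrank ℝ (EuclideanSpace ℂ (Fin d)) =
      Module.finrank ℝ (columnsOrthogonal W) := by
    rw [finrank_columnsOrthogonal hW, (WithLp.linearEquiv 2 ℝ (Fin d → ℂ)).finrank_eq]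
    simp [Module.finrank_pi_fintype, Complex.finrank_real_complex, mul_comm, hd]
  rw [map_norm_sq_isotropicGaussian_eq (F := columnsOrthogonal W) hfin,
    ← map_isotropicGaussian (columnsOrthogonal W).orthogonalProjectionOnto hpr
      (fun t => (t : EuclideanSpace ℂ m))
      (fun x t => (columnsOrthogonal W).inner_orthogonalProjectionOnto_eq_of_mem_right t x)
      (fun t => rfl),
    ← map_toLp_complexGaussianPi, Measure.map_map hsq hpr, Measure.map_map (hsq.comp hpr) hto]
  rfl

end AppendColumn

/-- The mean of the logarithm of the Gram determinant of a Gaussian matrix of size `m × n`. -/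
theorem hasLogMean_gramDet_complexGaussianPi (m n : ℕ) (h : n ≤ m) :
    HasLogMean (fun x : Fin m × Fin n → ℂ => gramDet (matrixOfEntries x))
      (complexGaussianPi (Fin m × Fin n)) (∑ l ∈ Finset.Icc 1 n, digammaNat (m - l + 1)) := by
  induction n with
  | zero =>
    have h1 : ∀ x : Fin m × Fin 0 → ℂ, gramDet (matrixOfEntries x) = 1 := fun x => by
      simp [gramDet]
    simp_rw [h1]
    exact ⟨by simp, by simp, by simp⟩
  | succ n ih =>
    let F : (Fin m × Fin n → ℂ) × (Fin m → ℂ) → ℝ := fun p =>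
      gramDet (Matrix.fromCols (matrixOfEntries p.1) (Matrix.replicateCol (Fin 1) p.2))
    have hF : Measurable F := by
      refine Continuous.measurable (continuous_gramDet.comp (continuous_matrix fun i j => ?_))
      rcases j with j | j
      · exact (continuous_matrixOfEntries.comp continuous_fst).matrix_elem i j
      · exact (continuous_apply i).comp continuous_snd
    have hsplit : ∀ x : Fin m × Fin (n + 1) → ℂ, gramDet (matrixOfEntries x) =
        F (fun q => x (q.1, q.2.castSucc), fun i => x (i, Fin.last n)) := by
      intro x
      rw [← gramDet_submatrix_equiv _ (finSumFinEquiv (m := n) (n := 1))]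
      congr 1
      ext i j
      rcases j with j | j
      · rfl
      · rw [Subsingleton.elim j 0]
        rfl
    have hlaw := map_prodMk_complexGaussianPi
      (f := fun q : Fin m × Fin n => (q.1, q.2.castSucc)) (g := fun i : Fin m => (i, Fin.last n))
      (fun a b hab => by simpa [Prod.ext_iff] using hab) (fun a b hab => by simpa using hab)
      (fun a b hab => by simpa [Fin.ext_iff, a.2.isLt.ne] using congrArg Prod.snd hab)
    simp_rw [hsplit]
    rw [← HasLogMean.map_iff (T := fun x : Fin m × Fin (n + 1) → ℂ =>
      ((fun q : Fin m × Fin n => x (q.1, q.2.castSucc)), fun i : Fin m => x (i, Fin.last n)))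
      (Measurable.aemeasurable (by fun_prop)) hF, hlaw,
      -- The new summand `l = n + 1` is the digamma value at `m - n`, the complex dimension
      -- orthogonal to the first `n` columns.
      Finset.sum_Icc_succ_top (by omega), show m - (n + 1) + 1 = m - n by omega]
    refine HasLogMean.mul_of_law (ih (by omega))
      (measurable_gramDet_of continuous_matrixOfEntries) hF
      (ρ := (isotropicGaussian (EuclideanSpace ℂ (Fin (m - n)))).map (fun y => ‖y‖ ^ 2)) ?_ ?_
    · rw [HasLogMean.map_iff (Measurable.aemeasurable (by fun_prop)) measurable_id]
      refine hasLogMean_norm_sq_isotropicGaussian (by omega) ?_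
      rw [(WithLp.linearEquiv 2 ℝ (Fin (m - n) → ℂ)).finrank_eq]
      simp [Module.finrank_pi_fintype, Complex.finrank_real_complex, mul_comm]
    · intro a ha
      exact exists_gramDet_fromCols_eq (by simp) _ ha

/-! ### Induction along the chain of factors -/

section Chain

variable {K : ℕ} {N : Fin (K + 1) → ℕ}

theorem chainProd_zero (Q : ∀ k : Fin K, Matrix (Fin (N k.succ)) (Fin (N k.castSucc)) ℂ) :
    chainProd Q 0 = 1 := rfl

theorem chainProd_succ (Q : ∀ k : Fin K, Matrix (Fin (N k.succ)) (Fin (N k.castSucc)) ℂ)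
    (k : Fin K) : chainProd Q k.succ = Q k * chainProd Q k.castSucc := rfl

theorem chainProd_congr {Q Q' : ∀ k : Fin K, Matrix (Fin (N k.succ)) (Fin (N k.castSucc)) ℂ}
    (i : Fin (K + 1)) (h : ∀ k : Fin K, k.castSucc < i → Q k = Q' k) :
    chainProd Q i = chainProd Q' i := by
  induction i using Fin.induction with
  | zero => rfl
  | succ k ih =>
    rw [chainProd_succ, chainProd_succ, h k k.castSucc_lt_succ,
      ih fun j hj => h j (hj.trans k.castSucc_lt_succ)]

theorem continuous_chainProd (i : Fin (K + 1)) :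
    Continuous fun Q : (∀ k : Fin K, Matrix (Fin (N k.succ)) (Fin (N k.castSucc)) ℂ) =>
      chainProd Q i := by
  induction i using Fin.induction with
  | zero => exact continuous_const
  | succ k ih =>
    simp_rw [chainProd_succ]
    exact (continuous_apply k).matrix_mul ih

variable (N) in
/-- The index set of the entries of a chain of matrices. -/
abbrev ChainIndex : Type := (k : Fin K) × (Fin (N k.succ) × Fin (N k.castSucc))

/-- The chain of matrices with a given family of entries. -/
def chainOfEntries (x : ChainIndex N → ℂ) (k : Fin K) :
    Matrix (Fin (N k.succ)) (Fin (N k.castSucc)) ℂ :=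
  matrixOfEntries fun q => x ⟨k, q⟩

theorem continuous_chainOfEntries :
    Continuous (chainOfEntries : (ChainIndex N → ℂ) → (_ : Fin K) → _) :=
  continuous_pi fun k => continuous_matrixOfEntries.comp (by fun_prop)

/-- The chain of matrices whose entries before the index `i` are given, the others being zero. -/
def chainOfInitialEntries (i : Fin (K + 1)) (a : {e : ChainIndex N // e.1.castSucc < i} → ℂ) :
    ∀ k : Fin K, Matrix (Fin (N k.succ)) (Fin (N k.castSucc)) ℂ :=
  chainOfEntries fun e => if h : e.1.castSucc < i then a ⟨e, h⟩ else 0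

theorem continuous_chainOfInitialEntries (i : Fin (K + 1)) :
    Continuous (chainOfInitialEntries (N := N) i) := by
  refine continuous_chainOfEntries.comp (continuous_pi fun e => ?_)
  split_ifs <;> fun_prop

/-- The zero padding never enters the product up to `i`, which is thus a function of the earlier
entries alone. -/
theorem chainProd_chainOfInitialEntries (i : Fin (K + 1)) (x : ChainIndex N → ℂ) :
    chainProd (chainOfInitialEntries i fun e => x e.1) i = chainProd (chainOfEntries x) i := by
  refine chainProd_congr i fun k hk => ?_
  ext a b
  simp [chainOfInitialEntries, chainOfEntries, matrixOfEntries, hk]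

theorem hasLogMean_gramDet_chainProd (hN : ∀ k, N 0 ≤ N k) (i : Fin (K + 1)) :
    HasLogMean (fun x : ChainIndex N → ℂ => gramDet (chainProd (chainOfEntries x) i))
      (complexGaussianPi (ChainIndex N))
      (∑ k : Fin K with k.castSucc < i, ∑ l ∈ Finset.Icc 1 (N 0),
        digammaNat (N k.succ - l + 1)) := by
  induction i using Fin.induction with
  | zero =>
    simp_rw [chainProd_zero, gramDet_one]
    exact ⟨by simp, by simp, by simp⟩
  | succ k ih =>
    have hsum : (Finset.univ.filter fun j : Fin K => j.castSucc < k.succ) =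
        insert k (Finset.univ.filter fun j : Fin K => j.castSucc < k.castSucc) := by
      ext j
      simp only [Finset.mem_filter, Finset.mem_univ, true_and, Finset.mem_insert, Fin.lt_def,
        Fin.ext_iff, Fin.val_castSucc, Fin.val_succ]
      omega
    rw [hsum, Finset.sum_insert (by simp), add_comm (Finset.sum _ _)]
    let f : ({e : ChainIndex N // e.1.castSucc < k.castSucc} → ℂ) → ℝ := fun a =>
      gramDet (chainProd (chainOfInitialEntries k.castSucc a) k.castSucc)
    let F : ({e : ChainIndex N // e.1.castSucc < k.castSucc} → ℂ) ×
        (Fin (N k.succ) × Fin (N k.castSucc) → ℂ) → ℝ := fun p =>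
      gramDet (matrixOfEntries p.2 * chainProd (chainOfInitialEntries k.castSucc p.1) k.castSucc)
    have hfc := (continuous_chainProd k.castSucc).comp
      (continuous_chainOfInitialEntries (N := N) k.castSucc)
    have hf : Measurable f := (continuous_gramDet.comp hfc).measurable
    have hF : Measurable F := Continuous.measurable <| continuous_gramDet.comp <|
      (continuous_matrixOfEntries.comp continuous_snd).matrix_mul (hfc.comp continuous_fst)
    have hfx : ∀ x : ChainIndex N → ℂ,
        gramDet (chainProd (chainOfEntries x) k.castSucc) = f fun e => x e.1 := fun x => by
      simp only [f, chainProd_chainOfInitialEntries]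
    have hFx : ∀ x : ChainIndex N → ℂ, gramDet (chainProd (chainOfEntries x) k.succ) =
        F (fun e => x e.1, fun q => x ⟨k, q⟩) := fun x => by
      simp only [F, chainProd_chainOfInitialEntries, chainProd_succ]
      rfl
    simp_rw [hfx] at ih
    simp_rw [hFx]
    rw [← HasLogMean.map_iff (T := fun (x : ChainIndex N → ℂ)
        (e : {e : ChainIndex N // e.1.castSucc < k.castSucc}) => x e.1)
      (Measurable.aemeasurable (by fun_prop)) hf,
      map_comp_complexGaussianPi Subtype.val_injective] at ih
    rw [← HasLogMean.map_iff (T := fun x : ChainIndex N → ℂ =>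
        ((fun e : {e : ChainIndex N // e.1.castSucc < k.castSucc} => x e.1),
          fun q : Fin (N k.succ) × Fin (N k.castSucc) => x ⟨k, q⟩))
      (Measurable.aemeasurable (by fun_prop)) hF,
      map_prodMk_complexGaussianPi Subtype.val_injective sigma_mk_injective
        -- An entry of factor `k` cannot belong to a strictly earlier factor, so the two blocks are
        -- disjoint.
        (fun e q h => by
          have h1 := e.2
          rw [h] at h1
          exact lt_irrefl _ h1)]
    refine HasLogMean.mul_of_law ih hf hF
      (ρ := (complexGaussianPi (Fin (N k.succ) × Fin (N 0))).map
        fun y => gramDet (matrixOfEntries y)) ?_ ?_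
    · rw [HasLogMean.map_iff
        (measurable_gramDet_of continuous_matrixOfEntries).aemeasurable measurable_id]
      exact hasLogMean_gramDet_complexGaussianPi _ _ (hN k.succ)
    · exact fun a ha => exists_gramDet_mul_eq (m := Fin (N k.succ))
        (chainProd (chainOfInitialEntries k.castSucc a) k.castSucc) ha

end Chain

/-! ### The main theorem -/

theorem theorem1 {Ω : Type*} [MeasurableSpace Ω] (P : Measure Ω) [IsProbabilityMeasure P]
    (K : ℕ) (N : Fin (K + 1) → ℕ) (hN : ∀ k, N 0 ≤ N k)
    (Q : ∀ k : Fin K, Ω → Matrix (Fin (N k.succ)) (Fin (N k.castSucc)) ℂ)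
    (hlaw : ∀ (k : Fin K) (i : Fin (N k.succ)) (j : Fin (N k.castSucc)),
      HasLaw (fun ω => Q k ω i j) stdComplexGaussian P)
    (hindep : iIndepFun
      (fun (e : (k : Fin K) × (Fin (N k.succ) × Fin (N k.castSucc))) (ω : Ω) =>
        Q e.1 ω e.2.1 e.2.2) P)
    (H : Ω → Matrix (Fin (N (Fin.last K))) (Fin (N 0)) ℂ)
    (hH : ∀ ω, H ω = productMatrix (fun k => Q k ω)) :
    (∀ᵐ ω ∂P, ((H ω)ᴴ * H ω).det.im = 0 ∧ 0 < ((H ω)ᴴ * H ω).det.re) ∧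
    Integrable (fun ω => Real.log ((H ω)ᴴ * H ω).det.re) P ∧
    ((∫ ω, Real.log ((H ω)ᴴ * H ω).det.re ∂P : ℝ) : ℂ) =
      ∑ k : Fin K, ∑ l ∈ Finset.Icc 1 (N 0), Complex.digamma ((N k.succ : ℂ) - (l : ℂ) + 1) ∧
    ∫ ω, Real.log ((H ω)ᴴ * H ω).det.re ∂P =
      -((K : ℝ) * (N 0 : ℝ) * Real.eulerMascheroniConstant) +
        ∑ k : Fin K, ∑ l ∈ Finset.Icc 1 (N 0), ∑ r ∈ Finset.Icc 1 (N k.succ - l), 1 / (r : ℝ) := by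
  have hae : ∀ e : ChainIndex N, AEMeasurable (fun ω => Q e.1 ω e.2.1 e.2.2) P :=
    fun e => (hlaw e.1 e.2.1 e.2.2).aemeasurable
  have hmap : P.map (fun ω (e : ChainIndex N) => Q e.1 ω e.2.1 e.2.2) =
      complexGaussianPi (ChainIndex N) := by
    rw [(iIndepFun_iff_map_fun_eq_pi_map hae).1 hindep, complexGaussianPi]
    congr 1
    ext1 e
    exact (hlaw e.1 e.2.1 e.2.2).map_eq
  have hgauss := hasLogMean_gramDet_chainProd hN (Fin.last K)
  rw [← hmap] at hgauss
  have hmain := (HasLogMean.map_iff (aemeasurable_pi_lambda _ hae)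
    (measurable_gramDet_of
      ((continuous_chainProd (Fin.last K)).comp continuous_chainOfEntries))).1 hgauss
  have hHx : ∀ ω, gramDet (chainProd (chainOfEntries fun e : ChainIndex N =>
      Q e.1 ω e.2.1 e.2.2) (Fin.last K)) = ((H ω)ᴴ * H ω).det.re := fun ω => by
    rw [hH]
    rfl
  simp only [Function.comp_apply, hHx] at hmain
  have hval := hmain.integral_eq
  simp only [Fin.castSucc_lt_last, Finset.filter_true] at hval
  refine ⟨?_, hmain.integrable, ?_, ?_⟩
  · filter_upwards [hmain.pos] with ω hω
    exact ⟨by rw [det_conjTranspose_mul_self_eq_gramDet, Complex.ofReal_im], hω⟩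
  · rw [hval]
    push_cast
    refine Finset.sum_congr rfl fun k _ => Finset.sum_congr rfl fun l hl => ?_
    -- By minimality of `N 0`, truncated subtraction agrees with subtraction in `ℂ`.
    have hle : l ≤ N k.succ := (Finset.mem_Icc.1 hl).2.trans (hN _)
    rw [← Complex.digamma_natCast (by omega)]
    push_cast [Nat.cast_sub hle]
    rfl
  · rw [hval]
    simp only [digammaNat, Nat.add_sub_cancel, Finset.sum_add_distrib, Finset.sum_const,
      Nat.card_Icc, Finset.card_univ, Fintype.card_fin, nsmul_eq_mul]
    ring
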